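/- Let $\mu\ge 2$ and let $(V,\mathcal B)$ be a Steiner $2$-design $S(2,\mu,v)$, that is, $|V|=v$, every block in $\mathcal B$ is a $\mu$-subset of $V$, and any two distinct points lie together in exactly one block. Suppose that its replication number $r=\frac{v-1}{\mu-1}$ is odd. Let $\mathcal S$ be a Steiner spread in $(V,\mathcal B)$: a set of pairs $(V_i,\mathcal B_i)$ with $V_i\subsetneq V$ and $\mathcal B_i\subsetneq\mathcal B$, each of which is an $S(2,\mu,|V_i|)$, such that the sets $V_i$ partition $V$ into non-empty parts. Suppose that every replication number $\frac{|V_i|-1}{\mu-1}$ is odd. Let $H$ be the point-by-block incidence matrix over $\mathbb F_2$ of $(V,\ \mathcal B\setminus\bigcup_i\mathcal B_i)$, and let ranks be taken over $\mathbb F_2$. Here an $[[n,k;c]]$ entanglement-assisted quantum error-correcting code (EAQECC) is given by an isometric encoder that maps $k$ logical qubits and the sender's halves of $c$ maximally entangled pairs into $n$ physical qubits, while the receiver's halves are left untouched; its code space consists of all encoded states in $(\mathbb C^2)^{\otimes n}\otimes(\mathbb C^2)^{\otimes c}$. It is a CSS code with parity-check matrix $H$ if, for some $f_h,g_h\in\mathbb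 F_2^c$ chosen for each row $h$ of $H$, the code space is the set of states fixed by all the operators $X^{h}\otimes X^{f_h}$ and $Z^{h}\otimes Z^{g_h}$. Then there exists an $[[n,k;c]]$ EAQECC that is a CSS code with parity-check matrix $H$, where \[ n=\frac{v(v-1)}{\mu(\mu-1)}-\Bigl|\bigcup_i\mathcal B_i\Bigr|,\qquad c=\operatorname{rank}(HH^T)=\begin{cases}|\mathcal S|-1,&|\mathcal S|\text{ odd},\\ |\mathcal S|,&|\mathcal S|\text{ even},\end{cases}\qquad k=n-2\operatorname{rank}(H)+c. \] Moreover, if $|V_i|=w$ for all $i$, then $H$ is regular: every row of $H$ has exactly $r-\frac{w-1}{\mu-1}$ ones and every column has exactly $\mu$ ones. -/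

import Mathlib

/-- `(P, 𝓑)` is a 2-`(|P|, μ, lam)` design: every block is a `μ`-subset of the point set `P`, and
any two distinct points lie together in exactly `lam` blocks. -/
structure IsTwoDesign {V : Type*} [DecidableEq V] (μ lam : ℕ) (P : Finset V)
    (𝓑 : Finset (Finset V)) : Prop where
  block_subset : ∀ B ∈ 𝓑, B ⊆ P
  block_card : ∀ B ∈ 𝓑, B.card = μ
  pair_count : ∀ x ∈ P, ∀ y ∈ P, x ≠ y → (𝓑.filter fun B => x ∈ B ∧ y ∈ B).card = lam

/-- A Steiner 2-design `S(2, μ, |P|)`. -/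
def IsSteinerDesign {V : Type*} [DecidableEq V] (μ : ℕ) (P : Finset V)
    (𝓑 : Finset (Finset V)) : Prop :=
  IsTwoDesign μ 1 P 𝓑

/-- The replication number `(v - 1) / (μ - 1)` of an `S(2, μ, v)`, as an exact quotient. -/
def replicationNumber (μ v : ℕ) : ℚ := ((v : ℚ) - 1) / ((μ : ℚ) - 1)

/-- The replication number of an `S(2, μ, v)` is an odd natural number. -/
def HasOddReplication (μ v : ℕ) : Prop := ∃ r : ℕ, Odd r ∧ (r : ℚ) = replicationNumber μ v

/-- `D = (V', 𝓑')` is a (proper) subdesign of block size `μ` of the design `(P, 𝓑)`. -/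
def IsSubdesign {V : Type*} [DecidableEq V] (μ : ℕ) (P : Finset V) (𝓑 : Finset (Finset V))
    (D : Finset V × Finset (Finset V)) : Prop :=
  D.1 ⊂ P ∧ D.2 ⊂ 𝓑 ∧ IsSteinerDesign μ D.1 D.2

/-- `𝒮` is a Steiner spread in `(P, 𝓑)`: a set of subdesigns whose point sets partition `P`. -/
structure IsSteinerSpread {V : Type*} [DecidableEq V] (μ : ℕ) (P : Finset V)
    (𝓑 : Finset (Finset V)) (𝒮 : Finset (Finset V × Finset (Finset V))) : Prop where
  subdesign : ∀ D ∈ 𝒮, IsSubdesign μ P 𝓑 D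
  nonempty : ∀ D ∈ 𝒮, D.1.Nonempty
  disjoint : ∀ D ∈ 𝒮, ∀ D' ∈ 𝒮, D ≠ D' → Disjoint D.1 D'.1
  cover : 𝒮.biUnion Prod.fst = P

/-- The union of the block sets of the members of `𝒮`. -/
def spreadBlocks {V : Type*} [DecidableEq V] (𝒮 : Finset (Finset V × Finset (Finset V))) :
    Finset (Finset V) :=
  𝒮.biUnion Prod.snd

/-- The point-by-block incidence matrix over `𝔽₂`. -/
def incidenceMatrix {V : Type*} [DecidableEq V] (𝓑 : Finset (Finset V)) :
    Matrix V {B : Finset V // B ∈ 𝓑} (ZMod 2) :=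
  Matrix.of fun x B => if x ∈ B.1 then 1 else 0

/-- Every row of `H` has exactly `a` ones and every column has exactly `b` ones. -/
def IsRegularMatrix {R ι : Type*} [Fintype R] [Fintype ι] (H : Matrix R ι (ZMod 2)) (a b : ℚ) :
    Prop :=
  (∀ i, ((hammingNorm fun j => H i j : ℕ) : ℚ) = a) ∧
    (∀ j, ((hammingNorm fun i => H i j : ℕ) : ℚ) = b)

/-- The state space `(ℂ²)^{⊗ι}` of qubits labelled by `ι`, in coordinates for the computational
basis, which is indexed by the bit strings `ι → 𝔽₂`. -/
abbrev QubitSpace (ι : Type*) [Fintype ι] [DecidableEq ι] : Type _ :=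
  EuclideanSpace ℂ (ι → ZMod 2)

/-- The Pauli operator `X^a = ⊗ᵢ X^{aᵢ}`, i.e. `|x⟩ ↦ |x + a⟩`. -/
noncomputable def pauliX {ι : Type*} [Fintype ι] [DecidableEq ι] (a : ι → ZMod 2)
    (ψ : QubitSpace ι) : QubitSpace ι :=
  WithLp.toLp 2 fun x => ψ (x + a)

/-- The Pauli operator `Z^b = ⊗ᵢ Z^{bᵢ}`, i.e. `|x⟩ ↦ (-1)^{b·x} |x⟩`. -/
noncomputable def pauliZ {ι : Type*} [Fintype ι] [DecidableEq ι] (b : ι → ZMod 2)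
    (ψ : QubitSpace ι) : QubitSpace ι :=
  WithLp.toLp 2 fun x => (-1 : ℂ) ^ (b ⬝ᵥ x).val * ψ x

/-- The state `φ ⊗ |Φ⟩^{⊗c}`, where `φ` is a state of `k` logical qubits and
`|Φ⟩ = (|00⟩ + |11⟩) / √2`. The qubits `inl (inl _)` are the logical ones, `inl (inr _)` are the
sender's halves and `inr _` the receiver's halves of the `c` ebits. -/
noncomputable def withEbits {k c : ℕ} (φ : QubitSpace (Fin k)) :
    QubitSpace ((Fin k ⊕ Fin c) ⊕ Fin c) :=
  WithLp.toLp 2 fun z =>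
    φ (fun i => z (Sum.inl (Sum.inl i))) *
      if (fun j => z (Sum.inl (Sum.inr j))) = (fun j => z (Sum.inr j))
      then ((Real.sqrt 2 : ℂ) ^ c)⁻¹ else 0

/-- The operator `T ⊗ 1` acting on a state of the qubits `α ⊕ β`. -/
noncomputable def applyLeft {α ι β : Type*} [Fintype α] [DecidableEq α] [Fintype ι]
    [DecidableEq ι] [Fintype β] [DecidableEq β] (T : QubitSpace α →ₗᵢ[ℂ] QubitSpace ι)
    (Ψ : QubitSpace (α ⊕ β)) : QubitSpace (ι ⊕ β) :=
  WithLp.toLp 2 fun z =>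
    T (WithLp.toLp 2 fun w => Ψ (Sum.elim w fun j => z (Sum.inr j))) fun i => z (Sum.inl i)

/-- An `[[n, k; c]]` entanglement-assisted quantum code whose `n` physical qubits are labelled by
`ι`: the sender maps `k` logical qubits and her halves of `c` ebits isometrically into the `n`
physical qubits, while the receiver's halves of the ebits are left untouched. -/
structure EAQECC (ι : Type*) [Fintype ι] [DecidableEq ι] (n k c : ℕ) where
  length_eq : Fintype.card ι = n
  encoder : QubitSpace (Fin k ⊕ Fin c) →ₗᵢ[ℂ] QubitSpace ι

/-- The encoded state of `φ`, a state of the `n` physical qubits and the receiver's `c` qubits. -/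
noncomputable def EAQECC.encode {ι : Type*} [Fintype ι] [DecidableEq ι] {n k c : ℕ}
    (Q : EAQECC ι n k c) (φ : QubitSpace (Fin k)) : QubitSpace (ι ⊕ Fin c) :=
  applyLeft Q.encoder (withEbits φ)

/-- The code space. -/
def EAQECC.codeSpace {ι : Type*} [Fintype ι] [DecidableEq ι] {n k c : ℕ}
    (Q : EAQECC ι n k c) : Set (QubitSpace (ι ⊕ Fin c)) :=
  Set.range Q.encode

/-- `Q` is an entanglement-assisted CSS code with parity-check matrix `H`: its code space is the
simultaneous `+1`-eigenspace of check operators whose restrictions to the physical qubits are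
`X^h` and `Z^h` for the rows `h` of `H`; row `i` is completed on the receiver's `c` qubits by
`X^{F i}` and `Z^{G i}` respectively. -/
def EAQECC.IsCSS {ι : Type*} [Fintype ι] [DecidableEq ι] {n k c : ℕ} (Q : EAQECC ι n k c)
    {R : Type*} (H : Matrix R ι (ZMod 2)) : Prop :=
  ∃ F G : Matrix R (Fin c) (ZMod 2),
    Q.codeSpace = {Ψ | ∀ i, pauliX (Sum.elim (H i) (F i)) Ψ = Ψ ∧
      pauliZ (Sum.elim (H i) (G i)) Ψ = Ψ}

/-! The code comes from a construction valid for every binary `H`. Put `c = rank (H Hᵀ)` and factor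
`H Hᵀ = F Gᵀ` through dimension `c`. Completing the X-rows to `(H | F)` and the Z-rows to `(H | G)`
makes all checks commute, since `H Hᵀ + G Fᵀ = 0` in characteristic two. Their common fixed states
are supported on `Q = ker (H | G)` and constant on cosets of `A`, the row space of `(H | F)`.
Neither completion raises the rank, so `Q / A` has dimension `n + c - 2 rank H = k`. As `F` and `G`
have full column rank, this space is the image of an encoder acting on the sender's side only
(`exists_isCSS`).

The design enters only through `H Hᵀ`. Two points of one part have their unique block inside that
part, so no remaining block joins them; points of different parts keep theirs; a diagonal entry is a
difference of two odd replication numbers. Hence `H Hᵀ` is `J - I` on the parts with rows and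
columns repeated, and its rank is the even one of `|𝒮|` and `|𝒮| - 1`. -/

open Matrix

/-! ### Rank factorizations, isometries and a dimension bound -/

/-- Every matrix over a field factors through a space whose dimension is its rank. -/
theorem Matrix.exists_eq_mul_transpose_rank {K m n : Type*} [Field K] [Fintype m] [Fintype n]
    [DecidableEq m] [DecidableEq n] (M : Matrix m n K) :
    ∃ (F : Matrix m (Fin M.rank) K) (G : Matrix n (Fin M.rank) K), M = F * Gᵀ := by
  let e : LinearMap.range M.mulVecLin ≃ₗ[K] (Fin M.rank → K) :=
    LinearEquiv.ofFinrankEq _ _ (Module.finrank_fin_fun K).symm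
  refine ⟨LinearMap.toMatrix' ((LinearMap.range M.mulVecLin).subtype ∘ₗ e.symm.toLinearMap),
    (LinearMap.toMatrix' (e.toLinearMap ∘ₗ M.mulVecLin.rangeRestrict))ᵀ, ?_⟩
  rw [transpose_transpose, ← LinearMap.toMatrix'_comp]
  apply Matrix.toLin'.injective
  rw [Matrix.toLin'_toMatrix']
  refine LinearMap.ext fun x => ?_
  simp

theorem Matrix.surjective_mulVec_of_le_rank {K l : Type*} [Field K] [Fintype l] {c : ℕ}
    (N : Matrix (Fin c) l K) (hN : c ≤ N.rank) : Function.Surjective N.mulVec := by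
  have : LinearMap.range N.mulVecLin = ⊤ := by
    apply Submodule.eq_top_of_finrank_eq
    apply le_antisymm (Submodule.finrank_le _)
    simpa [Matrix.rank] using hN
  exact LinearMap.range_eq_top.mp this

/-- In a factorization through a space of dimension the rank, both factors have full rank. -/
theorem Matrix.surjective_transpose_mulVec_of_rank_mul {K m n : Type*} [Field K] [Fintype m]
    [Fintype n] {c : ℕ} (F : Matrix m (Fin c) K) (G : Matrix n (Fin c) K)
    (h : (F * Gᵀ).rank = c) :
    Function.Surjective Fᵀ.mulVec ∧ Function.Surjective Gᵀ.mulVec := by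
  constructor <;> apply surjective_mulVec_of_le_rank
  · rw [Matrix.rank_transpose]
    exact h.symm.le.trans (Matrix.rank_mul_le_left _ _)
  · exact h.symm.le.trans (Matrix.rank_mul_le_right _ _)

/-- Adjoining columns from the column space does not change the rank. -/
theorem Matrix.rank_fromCols_of_range_le {K m n o : Type*} [Field K] [Fintype n] [Fintype o]
    (H : Matrix m n K) (G : Matrix m o K)
    (h : LinearMap.range G.mulVecLin ≤ LinearMap.range H.mulVecLin) :
    (fromCols H G).rank = H.rank := by
  have : LinearMap.range (fromCols H G).mulVecLin = LinearMap.range H.mulVecLin := by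
    apply le_antisymm
    · rintro _ ⟨x, rfl⟩
      rw [mulVecLin_apply, fromCols_mulVec]
      exact add_mem ⟨_, rfl⟩ (h ⟨_, rfl⟩)
    · rintro _ ⟨x, rfl⟩
      exact ⟨Sum.elim x 0, by simp⟩
  rw [Matrix.rank, this, Matrix.rank]

/-- Pulling back along a surjective homomorphism `L` from a set of bit strings embedded by `j`,
and extending by zero, is up to normalization an isometry. -/
theorem exists_linearIsometry_pullback {Q α ι : Type*} [AddCommGroup Q] [Fintype Q]
    [Fintype α] [DecidableEq α] [Fintype ι] [DecidableEq ι]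
    (j : Q → ι → ZMod 2) (hj : Function.Injective j)
    (L : Q →+ (α → ZMod 2)) (hL : Function.Surjective L) :
    ∃ (T : QubitSpace α →ₗᵢ[ℂ] QubitSpace ι) (κ : ℂ), κ ≠ 0 ∧
      (∀ φ q, T φ (j q) = κ * φ (L q)) ∧ ∀ φ x, x ∉ Set.range j → T φ x = 0 := by
  classical
  obtain ⟨N, hN0, hN⟩ : ∃ N : ℕ, N ≠ 0 ∧
      ∀ u, (Finset.univ.filter fun q => L q = u).card = N := by
    refine ⟨(Finset.univ.filter fun q => L q = 0).card, ?_, fun u => ?_⟩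
    · exact Finset.card_ne_zero_of_mem (a := 0) (by simp)
    -- Every fibre of `L` is a translate of its kernel, so all have the same size `N`; this gives
    -- the normalization `κ = 1 / √N`.
    · obtain ⟨q₀, rfl⟩ := hL u
      refine Finset.card_bij' (fun q _ => q - q₀) (fun q _ => q + q₀) ?_ ?_ ?_ ?_ <;>
        simp +contextual
  let κ : ℂ := ((Real.sqrt N : ℝ) : ℂ)⁻¹
  have hκ : ‖κ‖ ^ 2 * N = 1 := by
    have : (N : ℝ) ≠ 0 := by exact_mod_cast hN0
    simp [κ, abs_of_nonneg (Real.sqrt_nonneg _), Real.sq_sqrt, this]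
  have hκ0 : κ ≠ 0 := by
    rintro h
    simp [h] at hκ
  let T₀ : QubitSpace α →ₗ[ℂ] QubitSpace ι :=
    { toFun := fun φ => WithLp.toLp 2 (Function.extend j (fun q => κ * φ (L q)) 0)
      map_add' := by
        intro φ φ'
        ext x
        by_cases hx : ∃ q, j q = x
        · obtain ⟨q, rfl⟩ := hx
          simp [hj.extend_apply, mul_add]
        · simp [Function.extend_apply' _ _ _ hx]
      map_smul' := by
        intro a φ
        ext x
        by_cases hx : ∃ q, j q = x
        · obtain ⟨q, rfl⟩ := hx
          simp [hj.extend_apply, mul_left_comm]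
        · simp [Function.extend_apply' _ _ _ hx] }
  have hT₁ : ∀ φ q, T₀ φ (j q) = κ * φ (L q) := fun φ q => by simp [T₀, hj.extend_apply]
  have hT₂ : ∀ φ x, x ∉ Set.range j → T₀ φ x = 0 := fun φ x hx => by
    simp [T₀, Function.extend_apply' _ _ _ hx]
  refine ⟨⟨T₀, fun φ => ?_⟩, κ, hκ0, hT₁, hT₂⟩
  rw [← sq_eq_sq₀ (norm_nonneg _) (norm_nonneg _), EuclideanSpace.norm_sq_eq,
    EuclideanSpace.norm_sq_eq]
  calc ∑ x, ‖T₀ φ x‖ ^ 2 = ∑ x ∈ Finset.univ.image j, ‖T₀ φ x‖ ^ 2 := by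
        refine (Finset.sum_subset (Finset.subset_univ _) fun x _ hx => ?_).symm
        rw [hT₂ φ x (by simpa using hx)]
        simp
    _ = ∑ q, ‖κ‖ ^ 2 * ‖φ (L q)‖ ^ 2 := by
        rw [Finset.sum_image fun _ _ _ _ h => hj h]
        simp [hT₁, mul_pow]
    _ = ∑ u, ∑ q with L q = u, ‖κ‖ ^ 2 * ‖φ (L q)‖ ^ 2 :=
        (Finset.sum_fiberwise _ _ _).symm
    _ = ∑ u, ‖φ u‖ ^ 2 := by
        refine Finset.sum_congr rfl fun u _ => ?_
        rw [Finset.sum_congr rfl (g := fun _ => ‖κ‖ ^ 2 * ‖φ u‖ ^ 2), Finset.sum_const, hN,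
          nsmul_eq_mul]
        · linear_combination ‖φ u‖ ^ 2 * hκ
        · intro q hq
          rw [(Finset.mem_filter.mp hq).2]

/-- Restrict `H` to its row space: the image is the column space of `H Hᵀ` and the kernel lies in
`ker H`, so `rank H - rank (H Hᵀ) ≤ n - rank H`. This makes `k` a natural number. -/
theorem mul_rank_le_card_add_rank_mul_transpose {R ι : Type*} [Fintype R] [Fintype ι]
    [DecidableEq ι] (H : Matrix R ι (ZMod 2)) :
    2 * H.rank ≤ Fintype.card ι + (H * Hᵀ).rank := by
  have h1 := (H.mulVecLin.domRestrict (LinearMap.range Hᵀ.mulVecLin)).finrank_range_add_finrank_ker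
  have h2 : Module.finrank (ZMod 2) (LinearMap.range Hᵀ.mulVecLin) = H.rank :=
    Matrix.rank_transpose H
  have h3 : LinearMap.range (H.mulVecLin.domRestrict (LinearMap.range Hᵀ.mulVecLin)) =
      LinearMap.range (H * Hᵀ).mulVecLin := by
    rw [mulVecLin_mul, LinearMap.range_domRestrict, LinearMap.range_comp]
  have h4 := H.mulVecLin.finrank_range_add_finrank_ker
  have h5 : Module.finrank (ZMod 2)
      (LinearMap.ker (H.mulVecLin.domRestrict (LinearMap.range Hᵀ.mulVecLin))) ≤
      Module.finrank (ZMod 2) (LinearMap.ker H.mulVecLin) := by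
    rw [LinearMap.ker_domRestrict]
    refine LinearMap.finrank_le_finrank_of_injective
      (f := (LinearMap.range Hᵀ.mulVecLin).subtype.restrict
        (p := (LinearMap.ker H.mulVecLin).submoduleOf (LinearMap.range Hᵀ.mulVecLin))
        (q := LinearMap.ker H.mulVecLin) (fun x hx => hx)) ?_
    intro x y hxy
    have h := congrArg (fun z : LinearMap.ker H.mulVecLin => z.1) hxy
    exact Subtype.ext (Subtype.ext h)
  rw [h3] at h1
  rw [h2] at h1
  simp only [Module.finrank_fintype_fun_eq_card] at h4
  simp only [Matrix.rank] at *
  omega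

/-! ### Pauli checks and the entanglement-assisted CSS code -/

/-- The simultaneous fixed space of the `Z`-checks consists of the states supported on the
orthogonal complement of the rows. -/
theorem pauliZ_eq_self_iff {ι : Type*} [Fintype ι] [DecidableEq ι] (b : ι → ZMod 2)
    (ψ : QubitSpace ι) : pauliZ b ψ = ψ ↔ ∀ x, b ⬝ᵥ x ≠ 0 → ψ x = 0 := by
  have h2 : ∀ t : ZMod 2, t ≠ 0 → (-1 : ℂ) ^ t.val = -1 := by
    intro t ht
    have : t = 1 := by revert t; decide
    subst this
    simp [ZMod.val_one]
  constructor
  · intro h x hx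
    have := congrArg (fun φ : QubitSpace ι => φ x) h
    simp only [pauliZ, h2 _ hx] at this
    have h3 : (2 : ℂ) * ψ x = 0 := by linear_combination -this
    simpa using h3
  · intro h
    ext x
    by_cases hx : b ⬝ᵥ x = 0
    · simp [pauliZ, hx]
    · simp [pauliZ, h x hx]

/-- A state fixed by `X^w` for all rows `w` of `W` is invariant under the row space of `W`. -/
theorem apply_add_vecMul_of_pauliX_eq {R ι : Type*} [Fintype R] [Fintype ι] [DecidableEq ι]
    (W : Matrix R ι (ZMod 2)) (ψ : QubitSpace ι) (h : ∀ i, pauliX (W i) ψ = ψ)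
    (a : R → ZMod 2) (x : ι → ZMod 2) : ψ (x + Wᵀ *ᵥ a) = ψ x := by
  classical
  have h1 : ∀ i (t : ZMod 2) y, ψ (y + t • W i) = ψ y := by
    intro i t y
    obtain rfl | rfl : t = 0 ∨ t = 1 := by revert t; decide
    · simp
    · simpa [pauliX] using congrArg (fun φ : QubitSpace ι => φ y) (h i)
  have h2 : ∀ (s : Finset R) y, ψ (y + ∑ i ∈ s, a i • W i) = ψ y := by
    intro s
    induction s using Finset.induction_on with
    | empty => simp
    | insert i s hi ih =>
      intro y
      rw [Finset.sum_insert hi, ← add_assoc, ih, h1]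
  have h3 : Wᵀ *ᵥ a = ∑ i, a i • W i := by
    ext x
    simp [mulVec, dotProduct, mul_comm]
  rw [h3, h2]

theorem EAQECC.encode_apply {ι : Type*} [Fintype ι] [DecidableEq ι] {n k c : ℕ}
    (C : EAQECC ι n k c) (φ : QubitSpace (Fin k)) (z : ι ⊕ Fin c → ZMod 2) :
    C.encode φ z = C.encoder (WithLp.toLp 2 fun w => φ (fun i => w (Sum.inl i)) *
      if (fun j => w (Sum.inr j)) = (fun j => z (Sum.inr j))
      then ((Real.sqrt 2 : ℂ) ^ c)⁻¹ else 0) fun i => z (Sum.inl i) := by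
  rfl

/-- Every binary matrix `H` is the parity-check matrix of an entanglement-assisted CSS code that
consumes `rank (H Hᵀ)` ebits. -/
theorem exists_isCSS {R ι : Type*} [Fintype R] [DecidableEq R] [Fintype ι] [DecidableEq ι]
    (H : Matrix R ι (ZMod 2)) (k : ℕ)
    (hk : k + 2 * H.rank = Fintype.card ι + (H * Hᵀ).rank) :
    ∃ C : EAQECC ι (Fintype.card ι) k (H * Hᵀ).rank, C.IsCSS H := by
  classical
  obtain ⟨F, G, hFG⟩ := (H * Hᵀ).exists_eq_mul_transpose_rank
  generalize hc : (H * Hᵀ).rank = c at *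
  obtain ⟨hF, hG⟩ := F.surjective_transpose_mulVec_of_rank_mul G (by rw [← hFG, hc])
  have hGF : G * Fᵀ = H * Hᵀ := by
    have := congrArg transpose hFG
    simpa using this.symm
  have hrF : (fromCols H F).rank = H.rank := by
    apply rank_fromCols_of_range_le
    rintro _ ⟨x, rfl⟩
    -- Since `Gᵀ` is onto, each `F x` is some `F Gᵀ y = H (Hᵀ y)`, a vector in the column space of
    -- `H`.
    obtain ⟨y, rfl⟩ := hG x
    refine ⟨Hᵀ *ᵥ y, ?_⟩
    simp [hFG]
  have hrG : (fromCols H G).rank = H.rank := by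
    apply rank_fromCols_of_range_le
    rintro _ ⟨x, rfl⟩
    obtain ⟨y, rfl⟩ := hF x
    refine ⟨Hᵀ *ᵥ y, ?_⟩
    simp [hGF]
  let Q := LinearMap.ker (fromCols H G).mulVecLin
  let A := LinearMap.range (fromCols H F)ᵀ.mulVecLin
  have hAQ : A ≤ Q := by
    rintro _ ⟨x, rfl⟩
    change fromCols H G *ᵥ ((fromCols H F)ᵀ *ᵥ x) = 0
    rw [mulVec_mulVec, transpose_fromCols, fromCols_mul_fromRows, hGF]
    rw [add_mulVec]
    exact funext fun i => CharTwo.add_self_eq_zero _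
  have hA : Module.finrank (ZMod 2) A = H.rank := (rank_transpose _).trans hrF
  have hQ : H.rank + Module.finrank (ZMod 2) Q = Fintype.card ι + c := by
    have := (fromCols H G).mulVecLin.finrank_range_add_finrank_ker
    rw [← Matrix.rank, hrG] at this
    simpa using this
  obtain ⟨e⟩ : Nonempty ((Q ⧸ A.submoduleOf Q) ≃ₗ[ZMod 2] (Fin k → ZMod 2)) := by
    apply FiniteDimensional.nonempty_linearEquiv_of_finrank_eq
    have h1 := (A.submoduleOf Q).finrank_quotient_add_finrank
    have h2 := (Submodule.submoduleOfEquivOfLe hAQ).finrank_eq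
    rw [h2, hA] at h1
    simp only [Module.finrank_fintype_fun_eq_card, Fintype.card_fin]
    omega
  let π : Q →ₗ[ZMod 2] (Fin k → ZMod 2) := e.toLinearMap ∘ₗ (A.submoduleOf Q).mkQ
  have hπ : Function.Surjective π := e.surjective.comp (Submodule.mkQ_surjective _)
  have hker : ∀ q : Q, π q = 0 ↔ (q : ι ⊕ Fin c → ZMod 2) ∈ A := by
    intro q
    simp only [π, LinearMap.comp_apply, LinearEquiv.coe_coe, e.map_eq_zero_iff,
      Submodule.mkQ_apply, Submodule.Quotient.mk_eq_zero]
    rfl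
  let j : Q → ι → ZMod 2 := fun q i => q.1 (Sum.inl i)
  have hj : Function.Injective j := by
    intro q q' h
    have h0 : fromCols H G *ᵥ (q - q' : Q).1 = 0 := (q - q').2
    have h1 : (q - q' : Q).1 ∘ Sum.inl = 0 := by
      ext i
      simpa [sub_eq_zero] using congrFun h i
    rw [fromCols_mulVec, h1, mulVec_zero, zero_add] at h0
    -- The receiver's part is killed by `G`, hence orthogonal to the range of `Gᵀ`, which is
    -- everything: the physical bits determine the receiver's bits on `Q`.
    have h2 : (q - q' : Q).1 ∘ Sum.inr = 0 := by
      apply dotProduct_eq_zero _ fun y => ?_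
      obtain ⟨x, rfl⟩ := hG y
      rw [dotProduct_comm, mulVec_transpose, ← dotProduct_mulVec, h0, dotProduct_zero]
    apply sub_eq_zero.mp
    ext (i | i)
    · exact congrFun h1 i
    · exact congrFun h2 i
  let L : Q →+ (Fin k ⊕ Fin c → ZMod 2) :=
    { toFun := fun q => Sum.elim (π q) (fun i => q.1 (Sum.inr i))
      map_zero' := by ext (i | i) <;> simp
      map_add' := fun q q' => by ext (i | i) <;> simp }
  have hL : Function.Surjective L := by
    intro u
    obtain ⟨q, hq⟩ := hπ (u ∘ Sum.inl)
    -- Adding an element of `A` leaves the logical value unchanged, and `Fᵀ` being onto lets it set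
    -- the receiver's bits at will.
    obtain ⟨y, hy⟩ := hF (u ∘ Sum.inr - q.1 ∘ Sum.inr)
    have ha : (fromCols H F)ᵀ *ᵥ y ∈ A := ⟨y, rfl⟩
    refine ⟨q + ⟨_, hAQ ha⟩, ?_⟩
    ext (i | i)
    · have := (hker ⟨_, hAQ ha⟩).mpr ha
      simp [L, this, hq]
    · have := congrFun hy i
      simp only [Pi.sub_apply, Function.comp_apply] at this
      simp [L, transpose_fromCols, fromRows_mulVec, this]
  obtain ⟨T, κ, hκ, hT₁, hT₂⟩ := exists_linearIsometry_pullback j hj L hL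
  let C : EAQECC ι (Fintype.card ι) k c := ⟨rfl, T⟩
  let s : ℂ := ((Real.sqrt 2 : ℂ) ^ c)⁻¹
  have hs : s ≠ 0 := by simp [s]
  have henc₁ : ∀ φ (q : Q), C.encode φ q.1 = κ * (φ (π q) * s) := by
    intro φ q
    rw [C.encode_apply]
    refine (hT₁ _ q).trans ?_
    simp [L, s]
  have henc₂ : ∀ φ (z : ι ⊕ Fin c → ZMod 2), z ∉ Q → C.encode φ z = 0 := by
    intro φ z hz
    rw [C.encode_apply]
    by_cases hx : (fun i => z (Sum.inl i)) ∈ Set.range j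
    · obtain ⟨q, hq⟩ := hx
      rw [← hq]
      refine (hT₁ _ q).trans ?_
      -- The physical bits of `z` extend to `q` in `Q`; as `z ∉ Q`, the receiver's bits of `q` and
      -- `z` differ, and the ebit factor vanishes.
      have : ¬ ((fun i => q.1 (Sum.inr i)) = fun i => z (Sum.inr i)) := by
        intro h
        apply hz
        have : z = q.1 := by
          ext (i | i)
          · exact (congrFun hq i).symm
          · exact (congrFun h i).symm
        rw [this]
        exact q.2
      simp [L, this]
    · exact hT₂ _ _ hx
  refine ⟨C, F, G, ?_⟩
  have hrow : ∀ i, Sum.elim (H i) (F i) ∈ A := fun i =>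
    ⟨Pi.single i 1, by ext (l | l) <;> simp [fromCols]⟩
  have hQ_iff : ∀ z, z ∈ Q ↔ ∀ i, Sum.elim (H i) (G i) ⬝ᵥ z = 0 := fun z => funext_iff
  ext Ψ
  constructor
  · rintro ⟨φ, rfl⟩ i
    constructor
    · ext z
      change C.encode φ (z + Sum.elim (H i) (F i)) = C.encode φ z
      by_cases hz : z ∈ Q
      · have h1 := henc₁ φ (⟨z, hz⟩ + ⟨_, hAQ (hrow i)⟩)
        rw [map_add, (hker ⟨_, hAQ (hrow i)⟩).mpr (hrow i), add_zero] at h1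
        exact h1.trans (henc₁ φ ⟨z, hz⟩).symm
      · rw [henc₂ φ z hz, henc₂]
        rwa [Q.add_mem_iff_left (hAQ (hrow i))]
    · rw [pauliZ_eq_self_iff]
      intro z hz
      exact henc₂ φ z fun h => hz ((hQ_iff z).mp h i)
  · intro h
    obtain ⟨σ, hσ⟩ := hπ.hasRightInverse
    -- The logical state is read off from `Ψ` at one representative of each coset of `A`, with the
    -- encoder's scalar `κ * s` divided out.
    refine ⟨WithLp.toLp 2 fun u => κ⁻¹ * s⁻¹ * Ψ (σ u).1, ?_⟩
    ext z
    by_cases hz : z ∈ Q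
    · rw [henc₁ _ ⟨z, hz⟩]
      -- The representative of the coset of `z` differs from `z` by a combination of X-rows, under
      -- which `Ψ` is invariant.
      have hmem : (σ (π ⟨z, hz⟩) - ⟨z, hz⟩ : Q).1 ∈ A := by
        rw [← hker, map_sub, hσ, sub_self]
      obtain ⟨y, hy⟩ := hmem
      have h1 := apply_add_vecMul_of_pauliX_eq (fromCols H F) Ψ (fun i => (h i).1) y z
      have h2 : z + (fromCols H F)ᵀ *ᵥ y = (σ (π ⟨z, hz⟩)).1 := by
        rw [mulVecLin_apply] at hy
        rw [hy]
        simp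
      rw [h2] at h1
      simp only [h1]
      field_simp
    · rw [henc₂ _ z hz]
      rw [hQ_iff] at hz
      push Not at hz
      obtain ⟨i, hi⟩ := hz
      exact ((pauliZ_eq_self_iff _ _).mp (h i).2 z hi).symm

/-! ### Counting in Steiner designs -/

/-- A point of a Steiner design `S(2, μ, v)` lies in `(v - 1) / (μ - 1)` blocks. -/
theorem IsSteinerDesign.card_filter_mem {V : Type*} [DecidableEq V] {μ : ℕ} (hμ : 2 ≤ μ)
    {P : Finset V} {𝓑 : Finset (Finset V)} (h : IsSteinerDesign μ P 𝓑) {x : V} (hx : x ∈ P) :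
    ((𝓑.filter fun B => x ∈ B).card : ℚ) = replicationNumber μ P.card := by
  -- Double count the pairs `(y, B)` with `y ≠ x` and both points in `B`.
  have key := Finset.sum_card_bipartiteAbove_eq_sum_card_bipartiteBelow (s := P.erase x)
    (t := 𝓑.filter fun B => x ∈ B) (fun y B => y ∈ B)
  have h1 : ∀ y ∈ P.erase x,
      ((𝓑.filter fun B => x ∈ B).bipartiteAbove (fun y B => y ∈ B) y).card = 1 := by
    intro y hy
    rw [Finset.bipartiteAbove, Finset.filter_filter]
    exact h.pair_count x hx y (Finset.mem_of_mem_erase hy) (Finset.ne_of_mem_erase hy).symm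
  have h2 : ∀ B ∈ 𝓑.filter fun B => x ∈ B,
      ((P.erase x).bipartiteBelow (fun y B => y ∈ B) B).card = μ - 1 := by
    intro B hB
    obtain ⟨hB, hxB⟩ := Finset.mem_filter.mp hB
    have : (P.erase x).bipartiteBelow (fun y B => y ∈ B) B = B.erase x := by
      ext y
      have hsub : y ∈ B → y ∈ P := fun hy => h.block_subset B hB hy
      simp only [Finset.mem_bipartiteBelow, Finset.mem_erase]
      tauto
    rw [this, Finset.card_erase_of_mem hxB, h.block_card B hB]
  rw [Finset.sum_congr rfl h1, Finset.sum_congr rfl h2, Finset.sum_const, Finset.sum_const,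
    Finset.card_erase_of_mem hx, smul_eq_mul, smul_eq_mul, mul_one] at key
  have hP : 1 ≤ P.card := Finset.card_pos.mpr ⟨x, hx⟩
  have key' : ((P.card - 1 : ℕ) : ℚ) =
      (((𝓑.filter fun B => x ∈ B).card * (μ - 1) : ℕ) : ℚ) := congrArg _ key
  push_cast [Nat.cast_sub hP, Nat.cast_sub (show 1 ≤ μ by omega)] at key'
  have hμ' : (μ : ℚ) - 1 ≠ 0 := by
    have : (2 : ℚ) ≤ μ := by exact_mod_cast hμ
    linarith
  rw [replicationNumber, eq_div_iff hμ', key']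

/-- A Steiner design `S(2, μ, v)` has `v (v - 1) / (μ (μ - 1))` blocks. -/
theorem IsSteinerDesign.card_blocks {V : Type*} [DecidableEq V] {μ : ℕ} (hμ : 2 ≤ μ)
    {P : Finset V} {𝓑 : Finset (Finset V)} (h : IsSteinerDesign μ P 𝓑) :
    (𝓑.card : ℚ) = (P.card : ℚ) * ((P.card : ℚ) - 1) / ((μ : ℚ) * ((μ : ℚ) - 1)) := by
  have key := Finset.sum_card_bipartiteAbove_eq_sum_card_bipartiteBelow (s := P)
    (t := 𝓑) (fun y B => y ∈ B)
  have h2 : ∀ B ∈ 𝓑, (P.bipartiteBelow (fun y B => y ∈ B) B).card = μ := by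
    intro B hB
    have : P.bipartiteBelow (fun y B => y ∈ B) B = B := by
      ext y
      have hsub : y ∈ B → y ∈ P := fun hy => h.block_subset B hB hy
      simp only [Finset.mem_bipartiteBelow]
      tauto
    rw [this, h.block_card B hB]
  rw [Finset.sum_congr rfl h2, Finset.sum_const, smul_eq_mul] at key
  have key' := congrArg (Nat.cast (R := ℚ)) key
  push_cast at key'
  have h1 : ∀ y ∈ P, ((𝓑.bipartiteAbove (fun y B => y ∈ B) y).card : ℚ) =
      replicationNumber μ P.card := fun y hy => h.card_filter_mem hμ hy
  rw [Finset.sum_congr rfl h1, Finset.sum_const, nsmul_eq_mul, replicationNumber] at key'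
  have hμ' : (2 : ℚ) ≤ μ := by exact_mod_cast hμ
  have hμ0 : (μ : ℚ) ≠ 0 := by linarith
  have hμ1 : (μ : ℚ) - 1 ≠ 0 := by linarith
  field_simp at key' ⊢
  linarith

/-! ### The rank of `J - I` with repeated rows and columns -/

/-- The matrix `J - I` over `𝔽₂` has rank `m` or `m - 1`, whichever is even. -/
theorem rank_of_ite_eq {S : Type*} [Fintype S] [DecidableEq S] [Nonempty S] :
    (Matrix.of fun i j : S => if i = j then (0 : ZMod 2) else 1).rank =
      if Odd (Fintype.card S) then Fintype.card S - 1 else Fintype.card S := by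
  set N : Matrix S S (ZMod 2) := Matrix.of fun i j => if i = j then (0 : ZMod 2) else 1 with hN
  have hmul : ∀ x : S → ZMod 2, N *ᵥ x = fun i => (∑ j, x j) + x i := by
    intro x
    ext i
    have h : ∀ j, N i j * x j = x j + if i = j then x j else 0 := by
      intro j
      by_cases hij : i = j <;> simp [hN, hij, CharTwo.add_self_eq_zero]
    simp [mulVec, dotProduct, h, Finset.sum_add_distrib]
  have hrn := N.mulVecLin.finrank_range_add_finrank_ker
  rw [← Matrix.rank, Module.finrank_fintype_fun_eq_card] at hrn
  -- A kernel vector is constant, equal to its own coordinate sum; a nonzero constant qualifies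
  -- exactly when the size is odd.
  have hker : ∀ x, x ∈ LinearMap.ker N.mulVecLin ↔ ∀ i, x i = ∑ j, x j := by
    intro x
    rw [LinearMap.mem_ker, mulVecLin_apply, hmul, funext_iff]
    refine forall_congr' fun i => ?_
    rw [Pi.zero_apply, CharTwo.add_eq_zero, eq_comm]
  split_ifs with hodd
  · have : LinearMap.ker N.mulVecLin = Submodule.span (ZMod 2) {fun _ => 1} := by
      ext x
      rw [hker, Submodule.mem_span_singleton]
      constructor
      · intro h
        exact ⟨∑ j, x j, by ext i; simp [← h i]⟩
      · rintro ⟨a, rfl⟩ i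
        have : (Fintype.card S : ZMod 2) = 1 := (ZMod.natCast_eq_one_iff_odd).mpr hodd
        simp [this]
    rw [this, finrank_span_singleton] at hrn
    · omega
    · intro h
      simpa using congrFun h (Classical.arbitrary S)
  · have : LinearMap.ker N.mulVecLin = ⊥ := by
      rw [eq_bot_iff]
      intro x hx
      rw [hker] at hx
      have h0 : ∑ j, x j = 0 := by
        have hc : (Fintype.card S : ZMod 2) = 0 :=
          (ZMod.natCast_eq_zero_iff_even).mpr (Nat.not_odd_iff_even.mp hodd)
        calc ∑ j, x j = ∑ _j : S, ∑ j, x j := Finset.sum_congr rfl fun i _ => hx i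
          _ = 0 := by simp [hc]
      ext i
      simp [hx i, h0]
    rw [this, finrank_bot] at hrn
    omega

/-- Each matrix is a submatrix of the other: pull back along `p` one way, choose a representative of
each fibre the other way. -/
theorem rank_of_ite_fiber_eq {V S : Type*} [Fintype V] [Fintype S] [DecidableEq S] [Nonempty S]
    (p : V → S) (hp : Function.Surjective p) :
    (Matrix.of fun x y : V => if p x = p y then (0 : ZMod 2) else 1).rank =
      if Odd (Fintype.card S) then Fintype.card S - 1 else Fintype.card S := by
  rw [← rank_of_ite_eq]
  apply le_antisymm
  · exact Matrix.rank_submatrix_le (Matrix.of fun i j : S => if i = j then (0 : ZMod 2) else 1) p p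
  · obtain ⟨σ, hσ⟩ := hp.hasRightInverse
    have := Matrix.rank_submatrix_le
      (Matrix.of fun x y : V => if p x = p y then (0 : ZMod 2) else 1) σ σ
    rwa [show (Matrix.of fun x y : V => if p x = p y then (0 : ZMod 2) else 1).submatrix σ σ =
        Matrix.of fun i j : S => if i = j then (0 : ZMod 2) else 1 by
      ext i j
      simp [hσ i, hσ j]] at this

/-! ### Incidence matrices and spreads -/

section Incidence

variable {V : Type*} [DecidableEq V]

theorem incidenceMatrix_mul_transpose_apply (𝓑 : Finset (Finset V)) (x y : V) :
    (incidenceMatrix 𝓑 * (incidenceMatrix 𝓑)ᵀ) x y =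
      ((𝓑.filter fun B => x ∈ B ∧ y ∈ B).card : ZMod 2) := by
  simp only [Matrix.mul_apply, Matrix.transpose_apply, incidenceMatrix, Matrix.of_apply,
    ← ite_and, mul_ite, mul_one, mul_zero]
  rw [Finset.sum_coe_sort 𝓑 fun B => if y ∈ B ∧ x ∈ B then (1 : ZMod 2) else 0]
  simp [and_comm]

theorem hammingNorm_incidenceMatrix_row (𝓑 : Finset (Finset V)) (x : V) :
    hammingNorm (fun B => incidenceMatrix 𝓑 x B) = (𝓑.filter fun B => x ∈ B).card := by
  refine Finset.card_bij (fun B _ => B.1) ?_ (fun _ _ _ _ h => Subtype.ext h) ?_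
  · rintro ⟨B, hB⟩ h
    simpa [incidenceMatrix, hB] using h
  · intro B hB
    obtain ⟨hB, hx⟩ := Finset.mem_filter.mp hB
    exact ⟨⟨B, hB⟩, by simp [incidenceMatrix, hx], rfl⟩

theorem hammingNorm_incidenceMatrix_col [Fintype V] (𝓑 : Finset (Finset V)) (B : {B // B ∈ 𝓑}) :
    hammingNorm (fun x => incidenceMatrix 𝓑 x B) = B.1.card := by
  simp [hammingNorm, incidenceMatrix]

end Incidence

section Spread

variable {V : Type*} [DecidableEq V] {μ : ℕ} {P : Finset V} {𝓑 : Finset (Finset V)}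
  {𝒮 : Finset (Finset V × Finset (Finset V))}

theorem IsSteinerSpread.spreadBlocks_subset (h𝒮 : IsSteinerSpread μ P 𝓑 𝒮) :
    spreadBlocks 𝒮 ⊆ 𝓑 :=
  Finset.biUnion_subset.mpr fun D hD => (h𝒮.subdesign D hD).2.1.1

theorem IsSteinerSpread.eq_of_mem (h𝒮 : IsSteinerSpread μ P 𝓑 𝒮)
    {D D' : Finset V × Finset (Finset V)} (hD : D ∈ 𝒮) (hD' : D' ∈ 𝒮) {x : V} (hx : x ∈ D.1)
    (hx' : x ∈ D'.1) : D = D' := by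
  by_contra hne
  exact Finset.disjoint_left.mp (h𝒮.disjoint D hD D' hD' hne) hx hx'

/-- A block of another member stays inside a part disjoint from `D.1`, so it misses `x`. -/
theorem IsSteinerSpread.filter_mem_spreadBlocks (h𝒮 : IsSteinerSpread μ P 𝓑 𝒮)
    {D : Finset V × Finset (Finset V)} (hD : D ∈ 𝒮) {x : V} (hx : x ∈ D.1) :
    ((spreadBlocks 𝒮).filter fun B => x ∈ B) = D.2.filter fun B => x ∈ B := by
  ext B
  simp only [spreadBlocks, Finset.mem_filter, Finset.mem_biUnion]
  constructor
  · rintro ⟨⟨D', hD', hB⟩, hxB⟩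
    obtain rfl := h𝒮.eq_of_mem hD hD' hx ((h𝒮.subdesign D' hD').2.2.block_subset B hB hxB)
    exact ⟨hB, hxB⟩
  · rintro ⟨hB, hxB⟩
    exact ⟨⟨D, hD, hB⟩, hxB⟩

/-- The number of blocks through a point that lie in no member of the spread. -/
theorem IsSteinerSpread.card_filter_mem_sdiff (hμ : 2 ≤ μ) (h𝓑 : IsSteinerDesign μ P 𝓑)
    (h𝒮 : IsSteinerSpread μ P 𝓑 𝒮)
    {D : Finset V × Finset (Finset V)} (hD : D ∈ 𝒮) {x : V} (hx : x ∈ D.1) :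
    (((𝓑 \ spreadBlocks 𝒮).filter fun B => x ∈ B).card : ℚ) =
      replicationNumber μ P.card - replicationNumber μ D.1.card := by
  have hsub := Finset.filter_subset_filter (fun B => x ∈ B) h𝒮.spreadBlocks_subset
  have h1 : ((𝓑 \ spreadBlocks 𝒮).filter fun B => x ∈ B) =
      (𝓑.filter fun B => x ∈ B) \ ((spreadBlocks 𝒮).filter fun B => x ∈ B) := by
    ext B
    simp only [Finset.mem_filter, Finset.mem_sdiff]
    tauto
  rw [h1, Finset.card_sdiff_of_subset hsub, Nat.cast_sub (Finset.card_le_card hsub),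
    h𝒮.filter_mem_spreadBlocks hD hx, h𝓑.card_filter_mem hμ ((h𝒮.subdesign D hD).1.1 hx),
    (h𝒮.subdesign D hD).2.2.card_filter_mem hμ hx]

theorem IsSteinerSpread.filter_pair_sdiff_eq_empty (h𝓑 : IsSteinerDesign μ P 𝓑)
    (h𝒮 : IsSteinerSpread μ P 𝓑 𝒮) {D : Finset V × Finset (Finset V)} (hD : D ∈ 𝒮) {x y : V}
    (hx : x ∈ D.1) (hy : y ∈ D.1) (hxy : x ≠ y) :
    ((𝓑 \ spreadBlocks 𝒮).filter fun B => x ∈ B ∧ y ∈ B) = ∅ := by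
  obtain ⟨hP, h𝓑D, hdes⟩ := h𝒮.subdesign D hD
  -- Both sets have exactly one element, so the block of `𝓑` through `x` and `y` is already a block
  -- of `D`.
  have heq : (D.2.filter fun B => x ∈ B ∧ y ∈ B) = 𝓑.filter fun B => x ∈ B ∧ y ∈ B := by
    apply Finset.eq_of_subset_of_card_le (Finset.filter_subset_filter _ h𝓑D.1)
    rw [hdes.pair_count x hx y hy hxy, h𝓑.pair_count x (hP.1 hx) y (hP.1 hy) hxy]
  rw [Finset.filter_eq_empty_iff]
  intro B hB hxyB
  obtain ⟨hB, hBs⟩ := Finset.mem_sdiff.mp hB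
  have : B ∈ D.2.filter fun B => x ∈ B ∧ y ∈ B := by
    rw [heq]
    exact Finset.mem_filter.mpr ⟨hB, hxyB⟩
  exact hBs (Finset.mem_biUnion.mpr ⟨D, hD, (Finset.mem_filter.mp this).1⟩)

theorem IsSteinerSpread.card_filter_pair_sdiff_eq_one (h𝓑 : IsSteinerDesign μ P 𝓑)
    (h𝒮 : IsSteinerSpread μ P 𝓑 𝒮) {D D' : Finset V × Finset (Finset V)} (hD : D ∈ 𝒮)
    (hD' : D' ∈ 𝒮) (hne : D ≠ D') {x y : V} (hx : x ∈ D.1) (hy : y ∈ D'.1) :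
    ((𝓑 \ spreadBlocks 𝒮).filter fun B => x ∈ B ∧ y ∈ B).card = 1 := by
  have hxy : x ≠ y := by
    rintro rfl
    exact hne (h𝒮.eq_of_mem hD hD' hx hy)
  rw [← h𝓑.pair_count x ((h𝒮.subdesign D hD).1.1 hx) y ((h𝒮.subdesign D' hD').1.1 hy) hxy]
  congr 1
  ext B
  simp only [Finset.mem_filter, Finset.mem_sdiff]
  refine ⟨fun h => ⟨h.1.1, h.2⟩, fun h => ⟨⟨h.1, fun hB => ?_⟩, h.2⟩⟩
  -- A spread block through both points would put them in the same part.
  obtain ⟨E, hE, hBE⟩ := Finset.mem_biUnion.mp hB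
  have hsub := (h𝒮.subdesign E hE).2.2.block_subset B hBE
  exact hne ((h𝒮.eq_of_mem hD hE hx (hsub h.2.1)).trans
    (h𝒮.eq_of_mem hD' hE hy (hsub h.2.2)).symm)

end Spread

/-! ### The Gram matrix and the theorem -/

/-- The Gram matrix of the rows vanishes inside the parts of the spread and is constantly `1`
between different parts. -/
theorem IsSteinerSpread.incidenceMatrix_mul_transpose {V : Type*} [Fintype V] [DecidableEq V]
    {μ : ℕ} (hμ : 2 ≤ μ) {𝓑 : Finset (Finset V)} (h𝓑 : IsSteinerDesign μ Finset.univ 𝓑)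
    (hr : HasOddReplication μ (Fintype.card V))
    {𝒮 : Finset (Finset V × Finset (Finset V))} (h𝒮 : IsSteinerSpread μ Finset.univ 𝓑 𝒮)
    (hodd : ∀ D ∈ 𝒮, HasOddReplication μ D.1.card)
    (p : V → {D // D ∈ 𝒮}) (hp : ∀ x, x ∈ (p x).1.1) :
    incidenceMatrix (𝓑 \ spreadBlocks 𝒮) * (incidenceMatrix (𝓑 \ spreadBlocks 𝒮))ᵀ =
      Matrix.of fun x y => if p x = p y then 0 else 1 := by
  ext x y
  rw [incidenceMatrix_mul_transpose_apply, Matrix.of_apply]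
  split_ifs with h
  · by_cases hxy : x = y
    · subst hxy
      obtain ⟨r, hrodd, hr⟩ := hr
      obtain ⟨r', hrodd', hr'⟩ := hodd _ (p x).2
      have h1 := h𝒮.card_filter_mem_sdiff hμ h𝓑 (p x).2 (hp x)
      rw [Finset.card_univ, ← hr, ← hr', eq_sub_iff_add_eq] at h1
      norm_cast at h1
      simp only [and_self]
      rw [ZMod.natCast_eq_zero_iff_even]
      by_contra hcon
      rw [← h1] at hrodd
      exact Nat.not_odd_iff_even.mpr ((Nat.not_even_iff_odd.mp hcon).add_odd hrodd') hrodd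
    · have hy := hp y
      rw [← h] at hy
      simp [h𝒮.filter_pair_sdiff_eq_empty h𝓑 (p x).2 (hp x) hy hxy]
  · simp [h𝒮.card_filter_pair_sdiff_eq_one h𝓑 (p x).2 (p y).2 (fun e => h (Subtype.ext e)) (hp x)
      (hp y)]

theorem mainTheorem8 {V : Type*} [Fintype V] [DecidableEq V] (μ : ℕ) (hμ : 2 ≤ μ)
    (𝓑 : Finset (Finset V)) (h𝓑 : IsSteinerDesign μ Finset.univ 𝓑)
    (hr : HasOddReplication μ (Fintype.card V))
    (𝒮 : Finset (Finset V × Finset (Finset V))) (h𝒮 : IsSteinerSpread μ Finset.univ 𝓑 𝒮)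
    (hodd : ∀ D ∈ 𝒮, HasOddReplication μ D.1.card) :
    (∃ n k c : ℕ,
      (n : ℚ) = (Fintype.card V : ℚ) * ((Fintype.card V : ℚ) - 1) / ((μ : ℚ) * ((μ : ℚ) - 1))
        - ((spreadBlocks 𝒮).card : ℚ) ∧
      (Odd 𝒮.card → (c : ℤ) = (𝒮.card : ℤ) - 1) ∧
      (Even 𝒮.card → (c : ℤ) = (𝒮.card : ℤ)) ∧
      c = (incidenceMatrix (𝓑 \ spreadBlocks 𝒮) *
        (incidenceMatrix (𝓑 \ spreadBlocks 𝒮)).transpose).rank ∧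
      (k : ℤ) = (n : ℤ) - 2 * ((incidenceMatrix (𝓑 \ spreadBlocks 𝒮)).rank : ℤ) + (c : ℤ) ∧
      ∃ Q : EAQECC {B : Finset V // B ∈ 𝓑 \ spreadBlocks 𝒮} n k c,
        Q.IsCSS (incidenceMatrix (𝓑 \ spreadBlocks 𝒮))) ∧
    (∀ w : ℕ, (∀ D ∈ 𝒮, D.1.card = w) →
      IsRegularMatrix (incidenceMatrix (𝓑 \ spreadBlocks 𝒮))
        (replicationNumber μ (Fintype.card V) - ((w : ℚ) - 1) / ((μ : ℚ) - 1)) (μ : ℚ)) := by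
  classical
  have hcover : ∀ x : V, ∃ D : {D // D ∈ 𝒮}, x ∈ D.1.1 := by
    intro x
    have hx := Finset.mem_univ x
    rw [← h𝒮.cover] at hx
    obtain ⟨D, hD, hx⟩ := Finset.mem_biUnion.mp hx
    exact ⟨⟨D, hD⟩, hx⟩
  choose p hp using hcover
  constructor
  -- With no points the replication number would be `-1 / (μ - 1) < 0`, which is not a natural
  -- number. Nonemptiness makes `|𝒮| - 1` a genuine subtraction.
  · have hV : Nonempty V := by
      by_contra hempty
      rw [not_nonempty_iff] at hempty
      obtain ⟨r, -, hr⟩ := hr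
      have hμ' : (2 : ℚ) ≤ μ := by exact_mod_cast hμ
      rw [replicationNumber, Fintype.card_eq_zero, eq_div_iff (by linarith)] at hr
      have : (0 : ℚ) ≤ r * ((μ : ℚ) - 1) := mul_nonneg (Nat.cast_nonneg _) (by linarith)
      rw [hr] at this
      norm_num at this
    have hS : Nonempty {D // D ∈ 𝒮} := hV.map p
    have hsurj : Function.Surjective p := by
      rintro ⟨D, hD⟩
      obtain ⟨x, hx⟩ := h𝒮.nonempty D hD
      exact ⟨x, Subtype.ext (h𝒮.eq_of_mem (p x).2 hD (hp x) hx)⟩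
    have hrank := congrArg Matrix.rank
      (h𝒮.incidenceMatrix_mul_transpose hμ h𝓑 hr hodd p hp)
    rw [rank_of_ite_fiber_eq p hsurj, Fintype.card_coe] at hrank
    have hpos : 0 < 𝒮.card := by
      rw [← Fintype.card_coe]
      exact Fintype.card_pos
    have hle := mul_rank_le_card_add_rank_mul_transpose (incidenceMatrix (𝓑 \ spreadBlocks 𝒮))
    -- Unification takes `n` as the number of remaining blocks, `c` as the Gram rank and `k` as the
    -- natural difference `n + c - 2 * rank H`, which `hle` keeps from truncating.
    refine ⟨_, _, _, ?_, ?_, ?_, rfl, ?_,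
      exists_isCSS (incidenceMatrix (𝓑 \ spreadBlocks 𝒮)) _ (Nat.sub_add_cancel hle)⟩
    · rw [Fintype.card_coe, Finset.card_sdiff_of_subset h𝒮.spreadBlocks_subset,
        Nat.cast_sub (Finset.card_le_card h𝒮.spreadBlocks_subset), h𝓑.card_blocks hμ,
        Finset.card_univ]
    · intro h
      rw [hrank, if_pos h]
      omega
    · intro h
      rw [hrank, if_neg (Nat.not_odd_iff_even.mpr h)]
    · omega
  · intro w hw
    constructor
    · intro x
      rw [hammingNorm_incidenceMatrix_row, h𝒮.card_filter_mem_sdiff hμ h𝓑 (p x).2 (hp x),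
        hw _ (p x).2, Finset.card_univ]
      rfl
    · rintro ⟨B, hB⟩
      rw [hammingNorm_incidenceMatrix_col, h𝓑.block_card B (Finset.mem_sdiff.mp hB).1]
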